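/- Let $X^+,X^-,Y$ be independent standard one-dimensional Brownian motions started at $0$, put $X_t=X^+_t$ for $t\ge 0$ and $X_t=X^-_{-t}$ for $t<0$, and let $Z_t=x+X(Y_t)$, $t\ge 0$, be iterated Brownian motion started at $x\in\mathbb R$; write $P_x$ for the corresponding probability. For an open set $D\subseteq\mathbb R$ let $\tau_D(Z)=\inf\{t\ge 0: Z_t\notin D\}$ (with $\inf\emptyset=\infty$) be the lifetime of $Z$ in $D$. **Corollary 1.4.** Let $D\subseteq\mathbb R$ be a half-line, $D=(-\infty,a)$ or $D=(b,\infty)$ with $a,b\in\mathbb R$, and let $x\in D$. Then $P_x(\tau_D(Z)>t)\approx t^{-1/2}$ as $t\to\infty$; that is, there are constants $C_1,C_2,T>0$, depending only on $D$ and $x$, such that $$C_1\le \frac{P_x(\tau_D(Z)>t)}{t^{-1/2}}\le C_2\qquad\text{for all } t\ge T .$$ -/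

import Mathlib

open MeasureTheory ProbabilityTheory Set
open scoped NNReal

noncomputable section

/-- Two-sided process: `X t = X⁺ t` for `t ≥ 0` and `X t = X⁻ (-t)` for `t < 0`. -/
def twoSided {Ω : Type*} (Xp Xm : ℝ≥0 → Ω → ℝ) (t : ℝ) (ω : Ω) : ℝ :=
  if 0 ≤ t then Xp t.toNNReal ω else Xm (-t).toNNReal ω

/-- The iterated process started at `z`: `Z t = z + X (Y t)`, `t ≥ 0`, where `X` is the two-sided
process built from `Xp` and `Xm`. -/
def iteratedProcess {Ω : Type*} (Xp Xm Y : ℝ≥0 → Ω → ℝ) (z : ℝ) (t : ℝ≥0) (ω : Ω) : ℝ :=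
  z + twoSided Xp Xm (Y t ω) ω

/-- `Z` is a one-dimensional iterated Brownian motion started at `z`, on the space `(Ω, P)`:
`Z t = z + X (Y t)`, with `X` the two-sided Brownian motion built from `X⁺`, `X⁻`, where
`X⁺`, `X⁻`, `Y` are (mutually) independent standard one-dimensional Brownian motions. -/
def IsIteratedBrownianMotion {Ω : Type*} [MeasurableSpace Ω] (P : Measure Ω)
    (z : ℝ) (Z : ℝ≥0 → Ω → ℝ) : Prop :=
  ∃ Xp Xm Y : ℝ≥0 → Ω → ℝ,
    IsBrownianReal Xp P ∧ IsBrownianReal Xm P ∧ IsBrownianReal Y P ∧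
    iIndepFun (fun (i : Fin 3) (ω : Ω) (t : ℝ≥0) => (![Xp, Xm, Y] i) t ω) P ∧
    Z = iteratedProcess Xp Xm Y z

/-- The lifetime `τ_D(Z) = inf {t ≥ 0 : Z t ∉ D}`, with value `⊤` if `Z` never leaves `D`. -/
def lifetime {Ω : Type*} (Z : ℝ≥0 → Ω → ℝ) (D : Set ℝ) : Ω → WithTop ℝ≥0 :=
  hittingAfter Z Dᶜ 0

end

/-! Put `d = a - x`, `M⁺ = max Y` and `M⁻ = -min Y` over `[0, t]`. By continuity `Y` fills `[-M⁻,
M⁺]`, so `Z` stays below `a` up to time `t` when `X⁺` stays below `d` on `[0, M⁺]` and `X⁻` on `[0,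
M⁻]`. By the reflection principle a Brownian motion stays below `d` up to a large time `r` with
probability of order `d r^(-1/2)`. As `M⁺` and `M⁻` are of order `√t`, each side costs `t^(-1/4)`,
and the two sides are independent.

Upper bound: conditioning on `Y` (`measure_le_and_le_le_lintegral`) leaves `E[(M⁺ M⁻)^(-1/2)]`,
which is `t^(-1/2)` times the same moment of the extrema divided by `√t`. That moment has to be
bounded uniformly in `t`. Cauchy–Schwarz fails, since `E[1/M⁺] = ∞`. However, both scaled extrema
are at most `ε` with probability `O(ε²)`, against `O(ε)` for one of them, and `rpow_neg_half_mul_le`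
splits the product into moments that these two bounds control.

Lower bound: `Y` stays in an interval `[-L, L]` with `L` of order `√t` with probability at least
`1/2`; independence does the rest.

The reflection principle is needed only up to constants. It comes from Lévy's inequalities on dyadic
grids. Path events are expressed through countably many times, which makes them measurable for the
product σ-algebra, where independence is available. -/

/-! ### Elementary bounds for centered Gaussians -/

section Gaussian

open scoped ENNReal

lemma gaussianReal_zero_map_neg (v : ℝ≥0) :
    (gaussianReal 0 v).map (fun x ↦ -x) = gaussianReal 0 v := by
  simp [gaussianReal_map_neg]

lemma gaussianReal_zero_real_Iic_neg (v : ℝ≥0) (a : ℝ) :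
    (gaussianReal 0 v).real (Iic (-a)) = (gaussianReal 0 v).real (Ici a) := by
  conv_lhs => rw [← gaussianReal_zero_map_neg]
  rw [map_measureReal_apply (by fun_prop) measurableSet_Iic]
  congr 1
  ext x
  simp

lemma gaussianReal_zero_real_Iio_neg (v : ℝ≥0) (a : ℝ) :
    (gaussianReal 0 v).real (Iio (-a)) = (gaussianReal 0 v).real (Ioi a) := by
  conv_lhs => rw [← gaussianReal_zero_map_neg]
  rw [map_measureReal_apply (by fun_prop) measurableSet_Iio]
  congr 1
  ext x
  simp

lemma half_le_gaussianReal_zero_real_Ici (v : ℝ≥0) :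
    1 / 2 ≤ (gaussianReal 0 v).real (Ici 0) := by
  have h := gaussianReal_zero_real_Iic_neg v 0
  have h2 : (gaussianReal 0 v).real (Iic 0 ∪ Ici 0) = 1 := by
    rw [Iic_union_Ici]; simp
  have h3 := measureReal_union_le (μ := gaussianReal 0 v) (Iic (0 : ℝ)) (Ici 0)
  rw [neg_zero] at h
  linarith

lemma gaussianReal_zero_real_Ioi_le_half (v : ℝ≥0) :
    (gaussianReal 0 v).real (Ioi 0) ≤ 1 / 2 := by
  have h := gaussianReal_zero_real_Iio_neg v 0
  have h2 : (gaussianReal 0 v).real (Iio 0 ∪ Ioi 0) ≤ 1 := measureReal_le_one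
  rw [measureReal_union (by simp [Set.disjoint_left]; intros; linarith) measurableSet_Ioi] at h2
  rw [neg_zero] at h
  linarith

/-- One half of `P(|N| < a) = 1 - 2 P(N ≥ a)` for a centered Gaussian `N`. -/
lemma gaussianReal_zero_real_Ioo_le (v : ℝ≥0) {a : ℝ} (ha : 0 < a) :
    (gaussianReal 0 v).real (Ioo (-a) a) ≤ 1 - 2 * (gaussianReal 0 v).real (Ici a) := by
  have h := gaussianReal_zero_real_Iic_neg v a
  have h1 : (gaussianReal 0 v).real (Ioo (-a) a ∪ (Iic (-a) ∪ Ici a)) ≤ 1 := measureReal_le_one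
  rw [measureReal_union (by
      simp only [Set.disjoint_left, mem_Ioo, mem_union, mem_Iic, mem_Ici]; intro x; grind)
      (by measurability), measureReal_union (by
      simp only [Set.disjoint_left, mem_Iic, mem_Ici]; intro x; grind) (by measurability)] at h1
  linarith

/-- One half of `P(|N| ≤ a) = 1 - 2 P(N > a)` for a centered Gaussian `N`. -/
lemma one_sub_le_gaussianReal_zero_real_Icc (v : ℝ≥0) (a : ℝ) :
    1 - 2 * (gaussianReal 0 v).real (Ioi a) ≤ (gaussianReal 0 v).real (Icc (-a) a) := by
  have h := gaussianReal_zero_real_Iio_neg v a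
  have h1 : (gaussianReal 0 v).real (Icc (-a) a ∪ (Iio (-a) ∪ Ioi a)) = 1 := by
    rw [show Icc (-a) a ∪ (Iio (-a) ∪ Ioi a) = univ by ext x; simp; grind]
    simp
  have h2 := measureReal_union_le (μ := gaussianReal 0 v) (Icc (-a) a) (Iio (-a) ∪ Ioi a)
  have h3 := measureReal_union_le (μ := gaussianReal 0 v) (Iio (-a)) (Ioi a)
  linarith

/-- The density is at most `1 / √(2πv)`, and `2 ≤ √(2π)`. -/
lemma gaussianReal_zero_real_Icc_le {v : ℝ≥0} (hv : v ≠ 0) {a : ℝ} (ha : 0 ≤ a) :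
    (gaussianReal 0 v).real (Icc (-a) a) ≤ a / √v := by
  have hv' : (0 : ℝ) < v := by positivity
  have hs : 0 < √(v : ℝ) := by positivity
  rw [measureReal_def, gaussianReal_apply _ hv]
  have h1 : ∫⁻ x in Icc (-a) a, gaussianPDF 0 v x
      ≤ ∫⁻ _ in Icc (-a) a, ENNReal.ofReal (√(2 * Real.pi * v))⁻¹ := by
    gcongr with x
    rw [gaussianPDF, gaussianPDFReal]
    refine ENNReal.ofReal_le_ofReal (mul_le_of_le_one_right (by positivity) ?_)
    rw [Real.exp_le_one_iff]
    exact div_nonpos_of_nonpos_of_nonneg (by simp [sq_nonneg]) (by positivity)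
  refine ENNReal.toReal_le_of_le_ofReal (by positivity) (h1.trans ?_)
  rw [setLIntegral_const, Real.volume_Icc, ← ENNReal.ofReal_mul (by positivity)]
  refine ENNReal.ofReal_le_ofReal ?_
  have h2 : 2 * √(v : ℝ) ≤ √(2 * Real.pi * v) := by
    rw [show 2 * √(v : ℝ) = √(4 * v) by
      rw [Real.sqrt_mul (by norm_num), show (4 : ℝ) = 2 ^ 2 by norm_num,
        Real.sqrt_sq (by norm_num)]]
    gcongr
    linarith [Real.pi_gt_three]
  rw [inv_mul_eq_div, div_le_div_iff₀ (by positivity) hs]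
  nlinarith

/-- Within one standard deviation the exponent is at least `-1/2`, so `1 + y ≤ exp y` keeps the
density above half its peak; then `√(2π) ≤ 3`. -/
lemma le_gaussianReal_zero_real_Ioo {v : ℝ≥0} (hv : v ≠ 0) {a : ℝ} (ha : 0 < a) (hav : a ≤ √v) :
    a / (3 * √v) ≤ (gaussianReal 0 v).real (Ioo (-a) a) := by
  have hv' : (0 : ℝ) < v := by positivity
  have hs : 0 < √(v : ℝ) := by positivity
  rw [measureReal_def, ← ENNReal.ofReal_le_iff_le_toReal (measure_ne_top _ _),
    gaussianReal_apply _ hv]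
  have h1 : ∫⁻ _ in Ioo (-a) a, ENNReal.ofReal ((√(2 * Real.pi * v))⁻¹ * (1 / 2))
      ≤ ∫⁻ x in Ioo (-a) a, gaussianPDF 0 v x := by
    refine setLIntegral_mono (measurable_gaussianPDF _ _) fun x hx ↦ ?_
    rw [gaussianPDF, gaussianPDFReal]
    refine ENNReal.ofReal_le_ofReal ?_
    gcongr
    have h3 : x ^ 2 ≤ v := by
      have : x ^ 2 ≤ a ^ 2 := sq_le_sq' hx.1.le hx.2.le
      have : a ^ 2 ≤ v := by
        rw [← Real.sq_sqrt hv'.le]; gcongr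
      linarith
    have h4 : -(1 / 2) ≤ -(x - 0) ^ 2 / (2 * (v : ℝ)) := by
      rw [neg_div, neg_le_neg_iff, div_le_div_iff₀ (by positivity) (by norm_num)]
      linarith [sub_zero x ▸ h3]
    linarith [Real.add_one_le_exp (-(x - 0) ^ 2 / (2 * (v : ℝ)))]
  refine le_trans ?_ h1
  rw [setLIntegral_const, Real.volume_Ioo, ← ENNReal.ofReal_mul (by positivity)]
  refine ENNReal.ofReal_le_ofReal ?_
  have h2 : √(2 * Real.pi * v) ≤ 3 * √(v : ℝ) := by
    rw [show 3 * √(v : ℝ) = √(9 * v) by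
      rw [Real.sqrt_mul (by norm_num), show (9 : ℝ) = 3 ^ 2 by norm_num,
        Real.sqrt_sq (by norm_num)]]
    gcongr
    linarith [Real.pi_lt_four]
  rw [mul_assoc, inv_mul_eq_div]
  rw [div_le_div_iff₀ (by positivity) (by positivity)]
  nlinarith

lemma gaussianReal_zero_real_Ici_le {v : ℝ≥0} {a : ℝ} (ha : 0 < a) :
    (gaussianReal 0 v).real (Ici a) ≤ v / a ^ 2 := by
  have h := meas_ge_le_variance_div_sq (μ := gaussianReal 0 v) (X := id) (memLp_id_gaussianReal 2) ha
  simp only [id, integral_id_gaussianReal, sub_zero] at h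
  rw [variance_id_gaussianReal] at h
  refine ENNReal.toReal_le_of_le_ofReal (by positivity) (le_trans (measure_mono ?_) h)
  intro x hx
  simpa using le_trans hx (le_abs_self x)

end Gaussian

/-! ### Lévy's maximal inequalities in discrete time -/

section Reflection

variable {Ω : Type*} {mΩ : MeasurableSpace Ω} {P : Measure Ω}

/-- `S` reaches the level `d` for the first time at time `k`. -/
def firstPassage (S : ℕ → Ω → ℝ) (d : ℝ) (k : ℕ) : Set Ω :=
  {ω | (∀ j < k, S j ω < d) ∧ d ≤ S k ω}

lemma pairwise_disjoint_firstPassage (S : ℕ → Ω → ℝ) (d : ℝ) :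
    Pairwise (Function.onFun Disjoint (firstPassage S d)) := by
  intro i j hij
  rw [Function.onFun, Set.disjoint_left]
  rintro ω ⟨h1, h2⟩ ⟨h3, h4⟩
  rcases lt_or_gt_of_ne hij with h | h
  · linarith [h3 i h]
  · linarith [h1 j h]

lemma iUnion_firstPassage (S : ℕ → Ω → ℝ) (d : ℝ) (n : ℕ) :
    ⋃ k ∈ Finset.range (n + 1), firstPassage S d k = {ω | ∃ k ≤ n, d ≤ S k ω} := by
  ext ω
  simp only [mem_iUnion, mem_ofPred_eq, Finset.mem_range, Nat.lt_succ_iff, exists_prop]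
  constructor
  · rintro ⟨k, hk, h⟩
    exact ⟨k, hk, h.2⟩
  · rintro ⟨k, hk, h⟩
    classical
    have hex : ∃ k, d ≤ S k ω := ⟨k, h⟩
    exact ⟨Nat.find hex, (Nat.find_le h).trans hk,
      fun j hj ↦ not_le.1 (Nat.find_min hex hj), Nat.find_spec hex⟩

lemma nullMeasurableSet_firstPassage {S : ℕ → Ω → ℝ} (hS : ∀ k, AEMeasurable (S k) P)
    (d : ℝ) (k : ℕ) : NullMeasurableSet (firstPassage S d k) P := by
  have : firstPassage S d k = (⋂ j ∈ Iio k, {ω | S j ω < d}) ∩ {ω | d ≤ S k ω} := by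
    ext; simp [firstPassage]
  rw [this]
  exact (NullMeasurableSet.biInter (to_countable _) fun j _ ↦
    nullMeasurableSet_lt (hS j) aemeasurable_const).inter
      (nullMeasurableSet_le aemeasurable_const (hS k))

/-- First passage at time `k` is decided by `S 0, …, S k` alone. -/
lemma measureReal_firstPassage_inter {S : ℕ → Ω → ℝ} {d : ℝ} {k : ℕ} {R : Ω → ℝ}
    (h : IndepFun R (fun ω (j : Iic k) ↦ S j ω) P) {C : Set ℝ} (hC : MeasurableSet C) :
    P.real (firstPassage S d k ∩ R ⁻¹' C) = P.real (firstPassage S d k) * P.real (R ⁻¹' C) := by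
  have hA : MeasurableSet {f : Iic k → ℝ | (∀ j : Iic k, j.1 < k → f j < d) ∧ d ≤ f ⟨k, by simp⟩} := by
    measurability
  have := h.measure_inter_preimage_eq_mul _ _ hC hA
  have heq : (fun ω (j : Iic k) ↦ S j ω) ⁻¹' {f : Iic k → ℝ |
      (∀ j : Iic k, j.1 < k → f j < d) ∧ d ≤ f ⟨k, by simp⟩} = firstPassage S d k := by
    ext ω
    simp only [mem_preimage, mem_ofPred_eq, firstPassage, Subtype.forall, mem_Iic]
    exact and_congr_left fun _ ↦ ⟨fun H j hj ↦ H j hj.le hj, fun H j _ hj ↦ H j hj⟩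
  rw [heq] at this
  rw [measureReal_def, inter_comm, this, ENNReal.toReal_mul, mul_comm]
  rfl

variable [IsProbabilityMeasure P]

/-- **Lévy's maximal inequality**. -/
lemma measureReal_exists_ge_le {S : ℕ → Ω → ℝ} (hS : ∀ k, AEMeasurable (S k) P) {n : ℕ}
    (hind : ∀ k ≤ n, IndepFun (S n - S k) (fun ω (j : Iic k) ↦ S j ω) P)
    (hsymm : ∀ k ≤ n, 1 / 2 ≤ P.real ((S n - S k) ⁻¹' Ici 0)) (d : ℝ) :
    P.real {ω | ∃ k ≤ n, d ≤ S k ω} ≤ 2 * P.real {ω | d ≤ S n ω} := by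
  have h1 : P.real {ω | ∃ k ≤ n, d ≤ S k ω} =
      ∑ k ∈ Finset.range (n + 1), P.real (firstPassage S d k) := by
    rw [← iUnion_firstPassage, measureReal_biUnion_finset₀
      (fun i _ j _ hij ↦ (pairwise_disjoint_firstPassage S d hij).aedisjoint)
      (fun k _ ↦ nullMeasurableSet_firstPassage hS d k)]
  have h2 : ∑ k ∈ Finset.range (n + 1), P.real (firstPassage S d k ∩ (S n - S k) ⁻¹' Ici 0)
      ≤ P.real {ω | d ≤ S n ω} := by
    simp_rw [measureReal_def]
    rw [← ENNReal.toReal_sum (by simp), ← measure_biUnion_finset₀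
      (fun i _ j _ hij ↦ ((pairwise_disjoint_firstPassage S d hij).mono inter_subset_left
        inter_subset_left).aedisjoint)
      (fun k _ ↦ (nullMeasurableSet_firstPassage hS d k).inter
        (((hS n).sub (hS k)).nullMeasurable measurableSet_Ici))]
    refine ENNReal.toReal_mono (measure_ne_top _ _) (measure_mono ?_)
    refine iUnion₂_subset fun k _ ω hω ↦ ?_
    have h1 := hω.1.2
    have h2 : 0 ≤ S n ω - S k ω := hω.2
    simp only [mem_ofPred_eq]
    linarith
  rw [h1, Finset.sum_congr rfl fun k _ ↦ (by ring :
    P.real (firstPassage S d k) = 2 * (P.real (firstPassage S d k) * (1 / 2))), ← Finset.mul_sum]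
  refine mul_le_mul_of_nonneg_left (le_trans (Finset.sum_le_sum fun k hk ↦ ?_) h2) zero_le_two
  have hk : k ≤ n := Nat.lt_succ_iff.1 (Finset.mem_range.1 hk)
  rw [measureReal_firstPassage_inter (hind k hk) measurableSet_Ici]
  exact mul_le_mul_of_nonneg_left (hsymm k hk) measureReal_nonneg

/-- A converse to Lévy's maximal inequality, for walks with small steps. -/
lemma measureReal_gt_le {S : ℕ → Ω → ℝ} (hS : ∀ k, AEMeasurable (S k) P) {n : ℕ} {d e : ℝ} (he : 0 ≤ e)
    (h0 : ∀ᵐ ω ∂P, S 0 ω < d)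
    (hind : ∀ k ≤ n, IndepFun (S n - S k) (fun ω (j : Iic k) ↦ S j ω) P)
    (hsymm : ∀ k ≤ n, P.real ((S n - S k) ⁻¹' Ioi 0) ≤ 1 / 2) :
    2 * P.real {ω | d + e < S n ω} ≤ P.real {ω | ∃ k ≤ n, d ≤ S k ω} +
      2 * P.real {ω | ∃ k < n, e < S (k + 1) ω - S k ω} := by
  have h1 : P.real {ω | ∃ k ≤ n, d ≤ S k ω} =
      ∑ k ∈ Finset.range (n + 1), P.real (firstPassage S d k) := by
    rw [← iUnion_firstPassage, measureReal_biUnion_finset₀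
      (fun i _ j _ hij ↦ (pairwise_disjoint_firstPassage S d hij).aedisjoint)
      (fun k _ ↦ nullMeasurableSet_firstPassage hS d k)]
  set A := ⋃ k ∈ Finset.range (n + 1), firstPassage S d k ∩ (S n - S k) ⁻¹' Ioi 0 with hA
  set B := {ω | ∃ k < n, e < S (k + 1) ω - S k ω} with hB
  have h2 : P.real A ≤ ∑ k ∈ Finset.range (n + 1), P.real (firstPassage S d k) * (1 / 2) := by
    refine (measureReal_biUnion_finset_le _ _).trans (Finset.sum_le_sum fun k hk ↦ ?_)
    have hk : k ≤ n := Nat.lt_succ_iff.1 (Finset.mem_range.1 hk)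
    rw [measureReal_firstPassage_inter (hind k hk) measurableSet_Ioi]
    exact mul_le_mul_of_nonneg_left (hsymm k hk) measureReal_nonneg
  have h3 : P.real {ω | d + e < S n ω} ≤ P.real (A ∪ B) := by
    refine ENNReal.toReal_mono (measure_ne_top _ _) (measure_mono_ae ?_)
    filter_upwards [h0] with ω h0 hω
    have hω : d + e < S n ω := hω
    by_cases hb : ω ∈ B
    · exact Or.inr hb
    refine Or.inl ?_
    have hb' : ∀ k < n, S (k + 1) ω - S k ω ≤ e := by simpa [hB] using hb
    have hd : ∃ k ≤ n, d ≤ S k ω := ⟨n, le_rfl, by linarith⟩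
    have : ω ∈ ⋃ k ∈ Finset.range (n + 1), firstPassage S d k := by
      rw [iUnion_firstPassage]; exact hd
    simp only [mem_iUnion] at this
    obtain ⟨k, hk, hf⟩ := this
    simp only [hA, mem_iUnion]
    refine ⟨k, hk, hf, ?_⟩
    obtain _ | k := k
    · linarith [hf.2]
    -- The overshoot at the passage is at most `e`, so ending above `d + e` forces a positive
    -- increment afterwards.
    · have h4 := hf.1 k (by simp)
      have h5 := hb' k (by simpa using hk)
      simp only [mem_preimage, Pi.sub_apply, mem_Ioi]
      linarith
  have h4 := measureReal_union_le (μ := P) A B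
  rw [← Finset.sum_mul, ← h1] at h2
  linarith

end Reflection

/-! ### The reflection principle for Brownian motion -/

section BrownianMaximum

open Filter Topology

variable {Ω : Type*} {mΩ : MeasurableSpace Ω} {P : Measure Ω} {B : ℝ≥0 → Ω → ℝ}

lemma ProbabilityTheory.IsPreBrownianReal.indepFun_walk (hB : IsPreBrownianReal B P) (h : ℝ≥0) {k n : ℕ}
    (hk : k ≤ n) :
    IndepFun (B (n * h) - B (k * h)) (fun ω (j : Iic k) ↦ B (j * h) ω) P := by
  have hkn : (k : ℝ≥0) * h ≤ n * h := by gcongr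
  have hj (j : Iic k) : (j : ℕ) * h ∈ Iic (k * h) := by
    have : ((j : ℕ) : ℝ≥0) ≤ k := by exact_mod_cast j.2
    simp only [mem_Iic]
    gcongr
  have hm : Measurable fun f : ℝ≥0 → ℝ ↦ f (n * h - k * h) := measurable_pi_apply _
  have := (hB.indepFun_shift (k * h)).comp (φ := fun f : ℝ≥0 → ℝ ↦ f (n * h - k * h))
    (ψ := fun (f : Iic (k * h) → ℝ) (j : Iic k) ↦ f ⟨j * h, hj j⟩)
    hm
    (measurable_pi_lambda _ fun _ ↦ measurable_pi_apply _)
  convert this using 1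
  · ext ω
    simp [add_tsub_cancel_of_le hkn]
  · rfl

lemma ProbabilityTheory.IsPreBrownianReal.measureReal_sub_preimage (hB : IsPreBrownianReal B P) (s t : ℝ≥0)
    {C : Set ℝ} (hC : MeasurableSet C) :
    P.real ((B s - B t) ⁻¹' C) = (gaussianReal 0 (nndist s.1 t.1)).real C := by
  rw [← (hB.hasLaw_sub s t).map_eq,
    map_measureReal_apply_of_aemeasurable (hB.hasLaw_sub s t).aemeasurable hC]

lemma ProbabilityTheory.IsPreBrownianReal.measureReal_preimage (hB : IsPreBrownianReal B P) (t : ℝ≥0)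
    {C : Set ℝ} (hC : MeasurableSet C) :
    P.real (B t ⁻¹' C) = (gaussianReal 0 t).real C := by
  rw [← (hB.hasLaw_eval t).map_eq,
    map_measureReal_apply_of_aemeasurable (hB.hasLaw_eval t).aemeasurable hC]

/-- The dyadic point `i / 2 ^ n * T`. -/
noncomputable def dyadicPoint (T : ℝ≥0) (n i : ℕ) : ℝ≥0 := i * (T / 2 ^ n)

lemma dyadicPoint_top (T : ℝ≥0) (n : ℕ) : dyadicPoint T n (2 ^ n) = T := by
  simp [dyadicPoint, mul_div_cancel₀]

lemma dyadicPoint_le {T : ℝ≥0} {n i : ℕ} (hi : i ≤ 2 ^ n) : dyadicPoint T n i ≤ T := by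
  conv_rhs => rw [← dyadicPoint_top T n]
  unfold dyadicPoint
  gcongr

lemma dyadicPoint_two_mul (T : ℝ≥0) (n i : ℕ) :
    dyadicPoint T (n + 1) (2 * i) = dyadicPoint T n i := by
  simp only [dyadicPoint, pow_succ]
  push_cast
  field_simp

/-- The paths which lie below the level `d` at all dyadic points of `[0, T]`. -/
def belowOn (T : ℝ≥0) (d : ℝ) : Set (ℝ≥0 → ℝ) :=
  {f | ∀ n i : ℕ, i ≤ 2 ^ n → f (dyadicPoint T n i) < d}

lemma measurableSet_belowOn (T : ℝ≥0) (d : ℝ) : MeasurableSet (belowOn T d) := by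
  simp only [belowOn, ofPred_forall]
  exact .iInter fun n ↦ .iInter fun i ↦ .iInter fun _ ↦
    measurableSet_lt (measurable_pi_apply _) measurable_const

/-- The dyadic points `⌊2 ^ n s / T⌋ T / 2 ^ n` converge to `s`. -/
lemma exists_dyadicPoint_mem {T : ℝ≥0} {s : ℝ≥0} (hs : s ≤ T) {U : Set ℝ≥0} (hU : U ∈ 𝓝 s) :
    ∃ n i : ℕ, i ≤ 2 ^ n ∧ dyadicPoint T n i ∈ U := by
  obtain rfl | hT := eq_or_ne T 0
  · exact ⟨0, 0, by simp, by simpa [dyadicPoint, nonpos_iff_eq_zero.1 hs] using mem_of_mem_nhds hU⟩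
  have hT' : (0 : ℝ) < T := by positivity
  have hlim : Tendsto (fun n : ℕ ↦ dyadicPoint T n ⌊(s / T : ℝ) * 2 ^ n⌋₊) atTop (𝓝 s) := by
    rw [← NNReal.tendsto_coe]
    have h := ((tendsto_nat_floor_mul_div_atTop (R := ℝ) (a := s / T) (by positivity)).comp
      (tendsto_pow_atTop_atTop_of_one_lt (one_lt_two (α := ℝ)))).mul_const (T : ℝ)
    rw [div_mul_cancel₀ _ hT'.ne'] at h
    refine h.congr fun n ↦ ?_
    simp only [Function.comp_apply, dyadicPoint]
    push_cast
    ring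
  obtain ⟨n, hn⟩ := (hlim.eventually hU).exists
  refine ⟨n, _, Nat.floor_le_of_le ?_, hn⟩
  push_cast
  refine mul_le_of_le_one_left (by positivity) ((div_le_one hT').2 (by exact_mod_cast hs))

lemma le_of_mem_belowOn {T : ℝ≥0} {d : ℝ} {f : ℝ≥0 → ℝ} (hf : Continuous f)
    (h : f ∈ belowOn T d) {s : ℝ≥0} (hs : s ≤ T) : f s ≤ d := by
  by_contra! H
  obtain ⟨n, i, hi, h'⟩ := exists_dyadicPoint_mem hs (hf.continuousAt.preimage_mem_nhds (Ioi_mem_nhds H))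
  exact lt_asymm (h n i hi) h'

/-- The path has an increment larger than `e` over a dyadic interval of rank `n`. -/
def bigStep (B : ℝ≥0 → Ω → ℝ) (T : ℝ≥0) (e : ℝ) (n : ℕ) : Set Ω :=
  {ω | ∃ k < 2 ^ n, e < B (dyadicPoint T n (k + 1)) ω - B (dyadicPoint T n k) ω}

/-- Uniform continuity on `[0, T]` leaves almost every path with big steps at finitely many ranks
only. -/
lemma tendsto_measureReal_bigStep [IsProbabilityMeasure P] (hB : IsBrownianReal B P) (T : ℝ≥0)
    {e : ℝ} (he : 0 < e) : Tendsto (fun n ↦ P.real (bigStep B T e n)) atTop (𝓝 0) := by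
  have hm : ∀ n, NullMeasurableSet (bigStep B T e n) P := by
    intro n
    have : bigStep B T e n = ⋃ k ∈ Iio (2 ^ n),
      {ω | e < B (dyadicPoint T n (k + 1)) ω - B (dyadicPoint T n k) ω} := by
      ext; simp [bigStep]
    rw [this]
    exact NullMeasurableSet.biUnion (to_countable _) fun k _ ↦ nullMeasurableSet_lt
      aemeasurable_const ((hB.aemeasurable _).sub (hB.aemeasurable _))
  have hev : ∀ᵐ ω ∂P, ∀ᶠ n in atTop, ω ∉ bigStep B T e n := by
    filter_upwards [hB.cont] with ω hω
    have hu := (isCompact_Icc (a := (0 : ℝ≥0)) (b := T)).uniformContinuousOn_of_continuous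
      hω.continuousOn
    rw [Metric.uniformContinuousOn_iff] at hu
    obtain ⟨δ, hδ, hu⟩ := hu e he
    have hlim : Tendsto (fun n : ℕ ↦ (T : ℝ) / 2 ^ n) atTop (𝓝 0) :=
      tendsto_const_nhds.div_atTop (tendsto_pow_atTop_atTop_of_one_lt one_lt_two)
    filter_upwards [hlim.eventually_lt_const hδ] with n hn
    rintro ⟨k, hk, hlt⟩
    have := hu (dyadicPoint T n (k + 1)) ⟨by simp, dyadicPoint_le (by omega)⟩ (dyadicPoint T n k)
      ⟨by simp, dyadicPoint_le (by omega)⟩ (by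
        rw [NNReal.dist_eq]
        simp only [dyadicPoint]
        push_cast
        rw [← sub_mul, add_sub_cancel_left, one_mul, abs_of_nonneg (by positivity)]
        exact hn)
    rw [Real.dist_eq] at this
    linarith [le_abs_self (B (dyadicPoint T n (k + 1)) ω - B (dyadicPoint T n k) ω)]
  -- The events `bigStep` are not monotone in the rank, hence the tail unions.
  have h := tendsto_measure_iInter_atTop (μ := P) (s := fun N ↦ ⋃ n ∈ Ici N, bigStep B T e n)
    (fun N ↦ NullMeasurableSet.biUnion (to_countable _) fun n _ ↦ hm n)
    (fun N M hNM ↦ biUnion_subset_biUnion_left (Ici_subset_Ici.2 hNM)) ⟨0, by simp⟩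
  have h0 : P (⋂ N, ⋃ n ∈ Ici N, bigStep B T e n) = 0 := by
    rw [measure_eq_zero_iff_ae_notMem]
    filter_upwards [hev] with ω hω
    obtain ⟨N, hN⟩ := eventually_atTop.1 hω
    simp only [mem_iInter, mem_iUnion, not_forall]
    exact ⟨N, fun ⟨n, hn, h⟩ ↦ hN n hn h⟩
  rw [h0] at h
  have h' := tendsto_of_tendsto_of_tendsto_of_le_of_le tendsto_const_nhds h (fun n ↦ zero_le)
    (fun n ↦ measure_mono (subset_biUnion_of_mem (u := bigStep B T e) (mem_Ici.2 le_rfl)))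
  have := (ENNReal.tendsto_toReal ENNReal.zero_ne_top).comp h'
  rwa [ENNReal.toReal_zero] at this

/-- **Lévy's maximal inequality** for Brownian motion. -/
lemma measureReal_notMem_belowOn_le [IsProbabilityMeasure P] (hB : IsPreBrownianReal B P) (T : ℝ≥0)
    (d : ℝ) :
    P.real {ω | (B · ω) ∉ belowOn T d} ≤ 2 * (gaussianReal 0 T).real (Ici d) := by
  set A : ℕ → Set Ω := fun n ↦ {ω | ∃ i ≤ 2 ^ n, d ≤ B (dyadicPoint T n i) ω} with hA
  have hle : ∀ n, P.real (A n) ≤ 2 * (gaussianReal 0 T).real (Ici d) := by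
    intro n
    have := measureReal_exists_ge_le (P := P) (S := fun k ↦ B (k * (T / 2 ^ n))) (n := 2 ^ n)
      (fun k ↦ hB.aemeasurable _) (fun k hk ↦ IsPreBrownianReal.indepFun_walk hB _ hk) (fun k hk ↦ by
        rw [IsPreBrownianReal.measureReal_sub_preimage hB _ _ measurableSet_Ici]
        exact half_le_gaussianReal_zero_real_Ici _) d
    refine this.trans_eq ?_
    congr 1
    rw [← IsPreBrownianReal.measureReal_preimage hB _ measurableSet_Ici]
    conv_rhs => rw [← dyadicPoint_top T n]
    rfl
  have hmono : Monotone A := monotone_nat_of_le_succ fun n ω ⟨i, hi, h⟩ ↦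
    ⟨2 * i, by rw [pow_succ]; omega, by rwa [dyadicPoint_two_mul]⟩
  have hU : P.real (⋃ n, A n) ≤ 2 * (gaussianReal 0 T).real (Ici d) := by
    have h := tendsto_measure_iUnion_atTop (μ := P) hmono
    exact le_of_tendsto ((ENNReal.tendsto_toReal (by simp)).comp h) (Eventually.of_forall hle)
  convert hU using 2
  ext ω
  simp [belowOn, hA]

/-- The lower bound in the **reflection principle**. -/
lemma le_measureReal_mem_belowOn [IsProbabilityMeasure P] (hB : IsPreBrownianReal B P) (T : ℝ≥0)
    (d : ℝ) :
    1 - 2 * (gaussianReal 0 T).real (Ici d) ≤ P.real {ω | (B · ω) ∈ belowOn T d} := by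
  have h1 := measureReal_union_le (μ := P) {ω | (B · ω) ∈ belowOn T d} {ω | (B · ω) ∉ belowOn T d}
  rw [show {ω | (B · ω) ∈ belowOn T d} ∪ {ω | (B · ω) ∉ belowOn T d} = univ by
    ext; simp [em], probReal_univ] at h1
  linarith [measureReal_notMem_belowOn_le hB T d]

/-- The upper bound in the **reflection principle**, up to a change of the level. -/
lemma measureReal_mem_belowOn_le [IsProbabilityMeasure P] (hB : IsBrownianReal B P) (T : ℝ≥0)
    {d e : ℝ} (hd : 0 < d) (he : 0 < e) :
    P.real {ω | (B · ω) ∈ belowOn T d} ≤ (gaussianReal 0 T).real (Icc (-(d + e)) (d + e)) := by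
  have hlim := (tendsto_measureReal_bigStep hB T he).const_mul 2
  rw [mul_zero] at hlim
  have hle : ∀ n, 2 * (gaussianReal 0 T).real (Ioi (d + e)) ≤
      1 - P.real {ω | (B · ω) ∈ belowOn T d} + 2 * P.real (bigStep B T e n) := by
    intro n
    have := measureReal_gt_le (P := P) (S := fun k ↦ B (k * (T / 2 ^ n))) (n := 2 ^ n) (d := d)
      (fun k ↦ hB.aemeasurable _) he.le (by
        filter_upwards [hB.eval_zero_ae_eq_zero] with ω h
        simpa [h] using hd)
      (fun k hk ↦ IsPreBrownianReal.indepFun_walk hB.toIsPreBrownianReal _ hk) (fun k hk ↦ by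
        rw [IsPreBrownianReal.measureReal_sub_preimage hB.toIsPreBrownianReal _ _ measurableSet_Ioi]
        exact gaussianReal_zero_real_Ioi_le_half _)
    have h1 : (gaussianReal 0 T).real (Ioi (d + e)) =
        P.real {ω | d + e < B ((2 ^ n : ℕ) * (T / 2 ^ n)) ω} := by
      rw [← IsPreBrownianReal.measureReal_preimage hB.toIsPreBrownianReal _ measurableSet_Ioi]
      nth_rw 1 [← dyadicPoint_top T n]
      rfl
    have h2 : P.real {ω | ∃ k : ℕ, k ≤ 2 ^ n ∧ d ≤ B (k * (T / 2 ^ n)) ω} ≤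
        1 - P.real {ω | (B · ω) ∈ belowOn T d} := by
      have hm : NullMeasurableSet {ω | ∃ k : ℕ, k ≤ 2 ^ n ∧ d ≤ B (k * (T / 2 ^ n)) ω} P := by
        have : {ω | ∃ k : ℕ, k ≤ 2 ^ n ∧ d ≤ B (k * (T / 2 ^ n)) ω} = ⋃ k ∈ Iic (2 ^ n : ℕ),
          {ω | d ≤ B (k * (T / 2 ^ n)) ω} := by ext; simp
        rw [this]
        exact NullMeasurableSet.biUnion (to_countable _) fun k _ ↦ nullMeasurableSet_le
          aemeasurable_const (hB.aemeasurable _)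
      rw [le_sub_comm, ← probReal_compl_eq_one_sub₀ hm]
      refine measureReal_mono fun ω hω ↦ ?_
      simp only [mem_compl_iff, mem_ofPred_eq, not_exists, not_and, not_le]
      exact fun k hk ↦ hω n k hk
    rw [h1]
    exact this.trans (add_le_add_left h2 _)
  -- Only the mesh tends to `0`. The margin `e` stays fixed, which later costs no more than a
  -- constant factor.
  have := ge_of_tendsto (hlim.const_add (1 - P.real {ω | (B · ω) ∈ belowOn T d}))
    (Eventually.of_forall hle)
  have h3 := one_sub_le_gaussianReal_zero_real_Icc T (d + e)
  linarith

end BrownianMaximum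

/-! ### Measurable path functionals: hitting time and running maximum -/

section PathFunctionals

open Filter Topology TopologicalSpace
open scoped ENNReal

/-- The first point of a countable dense set of times at which the path `f` is at least `d`. -/
noncomputable def hitTime (d : ℝ) (f : ℕ → ℝ) : ℝ≥0∞ :=
  ⨅ n, if d ≤ f n then (denseSeq ℝ≥0 n : ℝ≥0∞) else ⊤

/-- The running maximum of the path `f` at time `t`, over a countable dense set of times. -/
noncomputable def runMax (t : ℝ≥0) (f : ℕ → ℝ) : ℝ≥0∞ :=
  ⨆ n, ⨆ _ : denseSeq ℝ≥0 n ≤ t, ENNReal.ofReal (f n)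

lemma measurable_hitTime (d : ℝ) : Measurable (hitTime d) :=
  .iInf fun n ↦ .ite (measurableSet_le measurable_const (measurable_pi_apply n)) measurable_const
    measurable_const

lemma measurable_runMax (t : ℝ≥0) : Measurable (runMax t) :=
  .iSup fun n ↦ .iSup fun _ ↦ (measurable_pi_apply n).ennreal_ofReal

/-- The restriction of a path to a countable dense set of times. -/
noncomputable def sample (f : ℝ≥0 → ℝ) (n : ℕ) : ℝ := f (denseSeq ℝ≥0 n)

lemma measurable_sample : Measurable sample :=
  measurable_pi_lambda _ fun _ ↦ measurable_pi_apply _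

/-- If `f s > d`, the open set `{f > d} ∩ U` is nonempty and contains a sample time. -/
lemma le_of_sample_le {f : ℝ≥0 → ℝ} (hf : Continuous f) {U : Set ℝ≥0} (hU : IsOpen U) {d : ℝ}
    (h : ∀ n, denseSeq ℝ≥0 n ∈ U → sample f n ≤ d) {s : ℝ≥0} (hs : s ∈ closure U) : f s ≤ d := by
  by_contra! H
  obtain ⟨r, hr, hrU⟩ := mem_closure_iff.1 hs _ (isOpen_lt continuous_const hf) H
  obtain ⟨_, ⟨hq, hqU⟩, n, rfl⟩ := (denseRange_denseSeq ℝ≥0).inter_open_nonempty _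
    ((isOpen_lt continuous_const hf).inter hU) ⟨r, hr, hrU⟩
  have := h n hqU
  simp only [sample, mem_ofPred_eq] at this hq
  linarith

lemma mem_belowOn_of_le {f : ℝ≥0 → ℝ} {r : ℝ≥0} {d e : ℝ} (hde : d < e)
    (h : ∀ s ≤ r, f s ≤ d) : f ∈ belowOn r e :=
  fun _ _ hi ↦ (h _ (dyadicPoint_le hi)).trans_lt hde

/-- Sample times before `r` give only `f ≤ d` on `[0, r]`; the gap `d < e` restores the strict
inequality in `belowOn`. -/
lemma mem_belowOn_of_le_hitTime {f : ℝ≥0 → ℝ} (hf : Continuous f) {r : ℝ≥0} (hr : 0 < r) {d e : ℝ}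
    (hde : d < e) (h : r ≤ hitTime d (sample f)) : f ∈ belowOn r e := by
  refine mem_belowOn_of_le hde fun s hs ↦ le_of_sample_le hf (isOpen_Iio (a := r)) (fun n hn ↦ ?_) (by
    rw [closure_Iio' (a := r) ⟨0, hr⟩]; exact hs)
  by_contra! H
  have h1 := h.trans (iInf_le _ n)
  rw [if_pos H.le] at h1
  exact absurd hn (not_lt.2 (by exact_mod_cast h1))

lemma le_of_runMax_le {f : ℝ≥0 → ℝ} (hf : Continuous f) {t : ℝ≥0} (ht : 0 < t) {a : ℝ≥0}
    (h : runMax t (sample f) ≤ a) {s : ℝ≥0} (hs : s ≤ t) : f s ≤ a := by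
  refine le_of_sample_le hf (isOpen_Iio (a := t)) (fun n hn ↦ ?_) (by
    rw [closure_Iio' (a := t) ⟨0, ht⟩]; exact hs)
  have h1 := (le_iSup₂ (f := fun n (_ : denseSeq ℝ≥0 n ≤ t) ↦ ENNReal.ofReal (sample f n))
    n hn.le).trans h
  exact Real.toNNReal_le_iff_le_coe.1 (ENNReal.coe_le_coe.1 h1)

/-- By the intermediate value theorem `Y` passes through every time below its maximum, so a time
with `X ≥ d` cannot lie there. This is used for `(X⁺, Y)` and for `(X⁻, -Y)`. -/
lemma runMax_le_hitTime {X Y : ℝ≥0 → ℝ} (hY : Continuous Y) (hY0 : Y 0 = 0) {t : ℝ≥0} {d : ℝ}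
    (h : ∀ s ≤ t, ∀ r : ℝ≥0, Y s = r → X r < d) :
    runMax t (sample Y) ≤ hitTime d (sample X) := by
  refine iSup₂_le fun n hn ↦ le_iInf fun m ↦ ?_
  split_ifs with hm
  · by_contra! H
    have H' : (denseSeq ℝ≥0 m : ℝ) < Y (denseSeq ℝ≥0 n) := by
      rw [← ENNReal.ofReal_coe_nnreal, ENNReal.ofReal_lt_ofReal_iff_of_nonneg (by positivity)] at H
      exact H
    obtain ⟨s, hs, hs'⟩ := intermediate_value_Icc (zero_le (a := denseSeq ℝ≥0 n)) hY.continuousOn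
      ⟨by rw [hY0]; positivity, H'.le⟩
    exact absurd hm (not_le.2 (h s (hs.2.trans hn) _ hs'))
  · exact le_top

end PathFunctionals

/-! ### Negative moments from small ball probabilities -/

section NegativeMoments

open scoped ENNReal

variable {Ω : Type*} {mΩ : MeasurableSpace Ω} {P : Measure Ω}

/-- A bound for `E[V ^ (-q)]` if `P(V ≤ ε) ≤ C ε ^ p` for all `ε`. -/
noncomputable def negMomentBound (C : ℝ≥0∞) (p q : ℝ) : ℝ≥0∞ :=
  1 + C * 2 ^ q * (1 - 2 ^ (q - p))⁻¹

lemma negMomentBound_ne_top {C : ℝ≥0∞} (hC : C ≠ ⊤) {p q : ℝ} (hqp : q < p) :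
    negMomentBound C p q ≠ ⊤ := by
  have h1 : (2 : ℝ≥0∞) ^ (q - p) < 1 :=
    ENNReal.rpow_lt_one_of_one_lt_of_neg (by norm_num) (by linarith)
  have h2 : (1 - (2 : ℝ≥0∞) ^ (q - p))⁻¹ ≠ ⊤ := by simpa [tsub_eq_zero_iff_le] using h1
  exact ENNReal.add_ne_top.2 ⟨by simp, ENNReal.mul_ne_top (ENNReal.mul_ne_top hC (by simp)) h2⟩

lemma two_rpow_neg_natCast (k : ℕ) : (2 : ℝ≥0∞) ^ (-(k : ℝ)) = ((2⁻¹ ^ k : ℝ≥0) : ℝ≥0∞) := by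
  rw [ENNReal.rpow_neg, ENNReal.rpow_natCast, ENNReal.coe_pow,
    ENNReal.coe_inv two_ne_zero, ENNReal.inv_pow]
  rfl

/-- Dyadic layers: if `2^(-(k+1)) < v ≤ 2^(-k)`, the `k`-th term alone dominates. For `v = 0` every
term is at least `1` and the sum diverges. -/
lemma rpow_neg_le_tsum {q : ℝ} (hq : 0 < q) (v : ℝ≥0∞) :
    v ^ (-q) ≤ 1 + ∑' k : ℕ, (Iic ((2 : ℝ≥0∞) ^ (-(k : ℝ)))).indicator
      (fun _ ↦ (2 : ℝ≥0∞) ^ ((k + 1) * q)) v := by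
  rcases le_total 1 v with h | h
  · exact (ENNReal.rpow_le_one_of_one_le_of_neg h (by linarith)).trans le_self_add
  obtain rfl | hv := eq_or_ne v 0
  · refine le_trans le_top (le_add_left (top_le_iff.2 ?_).ge)
    refine top_le_iff.1 ?_
    rw [← ENNReal.tsum_const_eq_top_of_ne_zero (α := ℕ) one_ne_zero]
    refine ENNReal.tsum_le_tsum fun k ↦ ?_
    rw [indicator_of_mem (by simp)]
    exact ENNReal.one_le_rpow (by norm_num) (by positivity)
  lift v to ℝ≥0 using ne_top_of_le_ne_top ENNReal.one_ne_top h
  have hv : 0 < v := pos_iff_ne_zero.2 (by simpa using hv)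
  obtain ⟨k, hk1, hk2⟩ := exists_nat_pow_near_of_lt_one hv (by exact_mod_cast h)
    (by norm_num : (0 : ℝ≥0) < 2⁻¹) (by norm_num)
  refine le_trans ?_ (le_add_left (ENNReal.le_tsum k))
  rw [indicator_of_mem]
  · have : (2 : ℝ≥0∞) ^ (-((k + 1 : ℕ) : ℝ)) ≤ v := by
      rw [two_rpow_neg_natCast]
      exact ENNReal.coe_le_coe.2 hk1.le
    calc (v : ℝ≥0∞) ^ (-q) ≤ ((2 : ℝ≥0∞) ^ (-((k + 1 : ℕ) : ℝ))) ^ (-q) := by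
          rw [ENNReal.rpow_neg, ENNReal.rpow_neg, ENNReal.inv_le_inv]
          exact ENNReal.rpow_le_rpow this hq.le
      _ = _ := by
          rw [← ENNReal.rpow_mul]; congr 1; push_cast; ring
  · rw [mem_Iic, two_rpow_neg_natCast]
    exact ENNReal.coe_le_coe.2 hk2

/-- Integrating the dyadic layers gives a geometric series of ratio `2^(q - p)`; its sum is finite
when `q < p`. -/
lemma lintegral_rpow_neg_le {V : Ω → ℝ≥0∞} (hV : AEMeasurable V P) [IsProbabilityMeasure P]
    {C : ℝ≥0∞} {p q : ℝ} (hq : 0 < q)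
    (h : ∀ ε : ℝ≥0, 0 < ε → P {ω | V ω ≤ ε} ≤ C * (ε : ℝ≥0∞) ^ p) :
    ∫⁻ ω, V ω ^ (-q) ∂P ≤ negMomentBound C p q := by
  have h2 (k : ℕ) : P {ω | V ω ≤ (2 : ℝ≥0∞) ^ (-(k : ℝ))} ≤ C * ((2 : ℝ≥0∞) ^ (-(k : ℝ))) ^ p := by
    rw [two_rpow_neg_natCast]
    exact h _ (by positivity)
  calc ∫⁻ ω, V ω ^ (-q) ∂P
      ≤ ∫⁻ ω, (1 + ∑' k : ℕ, (Iic ((2 : ℝ≥0∞) ^ (-(k : ℝ)))).indicator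
          (fun _ ↦ (2 : ℝ≥0∞) ^ ((k + 1) * q)) (V ω)) ∂P := 
        lintegral_mono fun ω ↦ rpow_neg_le_tsum hq (V ω)
    _ = 1 + ∑' k : ℕ, (2 : ℝ≥0∞) ^ ((k + 1) * q) * P {ω | V ω ≤ (2 : ℝ≥0∞) ^ (-(k : ℝ))} := by
        rw [lintegral_add_left measurable_const, lintegral_tsum]
        · simp only [lintegral_const, measure_univ, mul_one]
          congr 2 with k
          rw [← lintegral_map' (f := (Iic ((2 : ℝ≥0∞) ^ (-(k : ℝ)))).indicator
            (fun _ ↦ (2 : ℝ≥0∞) ^ ((k + 1) * q)))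
            (measurable_const.indicator measurableSet_Iic).aemeasurable hV,
            lintegral_indicator_const measurableSet_Iic,
            Measure.map_apply_of_aemeasurable hV measurableSet_Iic]
          rfl
        · exact fun k ↦ (measurable_const.indicator measurableSet_Iic).comp_aemeasurable hV
    _ ≤ 1 + ∑' k : ℕ, C * 2 ^ q * ((2 : ℝ≥0∞) ^ (q - p)) ^ k := by
        refine add_le_add_right (ENNReal.tsum_le_tsum fun k ↦ ?_) _
        refine (mul_le_mul_right (h2 k) _).trans_eq ?_
        have h3 : (2 : ℝ≥0∞) ^ ((k + 1) * q) * ((2 : ℝ≥0∞) ^ (-(k : ℝ))) ^ p =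
            2 ^ q * ((2 : ℝ≥0∞) ^ (q - p)) ^ k := by
          rw [← ENNReal.rpow_mul, ← ENNReal.rpow_natCast, ← ENNReal.rpow_mul,
            ← ENNReal.rpow_add _ _ (by norm_num) (by norm_num),
            ← ENNReal.rpow_add _ _ (by norm_num) (by norm_num)]
          congr 1; ring
        rw [mul_left_comm, h3, mul_assoc]
    _ = negMomentBound C p q := by
        rw [ENNReal.tsum_mul_left, ENNReal.tsum_geometric]
        rfl

lemma rpow_neg_half_mul_le (a b : ℝ≥0∞) :
    a ^ (-(1 / 2) : ℝ) * b ^ (-(1 / 2) : ℝ) ≤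
      a ^ (-(3 / 4) : ℝ) + b ^ (-(3 / 4) : ℝ) + max a b ^ (-(3 / 2) : ℝ) := by
  wlog hab : a ≤ b generalizing a b
  · rw [mul_comm, max_comm, add_comm (a ^ _)]
    exact this b a (le_of_not_ge hab)
  rw [max_eq_right hab]
  -- These exponents give the smaller variable order `3/4 < 1` and the larger one order `3/2 < 2`,
  -- below the small ball exponents `1` (one extremum) and `2` (both).
  have hpq : (3 / 2 : ℝ).HolderConjugate 3 := by
    rw [Real.holderConjugate_iff]; norm_num
  have hy := ENNReal.young_inequality (a ^ (-(1 / 2) : ℝ)) (b ^ (-(1 / 2) : ℝ)) hpq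
  rw [← ENNReal.rpow_mul, ← ENNReal.rpow_mul] at hy
  norm_num at hy ⊢
  refine hy.trans ?_
  refine add_le_add (le_trans ?_ le_self_add) ?_
  · exact ENNReal.div_le_of_le_mul (le_mul_of_one_le_right' (by
      rw [← ENNReal.ofReal_one]; exact ENNReal.ofReal_le_ofReal (by norm_num)))
  · exact ENNReal.div_le_of_le_mul (le_mul_of_one_le_right' (by norm_num))

end NegativeMoments

/-! ### Survival and small ball estimates for Brownian motion -/

section BrownianEstimates

open scoped ENNReal

variable {Ω : Type*} {mΩ : MeasurableSpace Ω} {P : Measure Ω} {B : ℝ≥0 → Ω → ℝ}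

lemma aemeasurable_sample (hB : ∀ t, AEMeasurable (B t) P) :
    AEMeasurable (fun ω ↦ sample (B · ω)) P :=
  aemeasurable_pi_lambda _ fun _ ↦ hB _

lemma coe_rpow_neg_half {r : ℝ≥0} (hr : 0 < r) :
    (r : ℝ≥0∞) ^ (-(1 / 2) : ℝ) = ENNReal.ofReal (√r)⁻¹ := by
  rw [ENNReal.rpow_neg, ENNReal.ofReal_inv_of_pos (by positivity), Real.sqrt_eq_rpow,
    ← ENNReal.ofReal_rpow_of_nonneg (by positivity) (by positivity), ENNReal.ofReal_coe_nnreal]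

variable [IsProbabilityMeasure P]

/-- A Brownian motion stays below the level `d` until time `r` with probability `O(r ^ (-1/2))`. -/
lemma measure_le_hitTime_le (hB : IsBrownianReal B P) {d : ℝ} (hd : 0 < d) (r : ℝ≥0∞) :
    P {ω | r ≤ hitTime d (sample (B · ω))} ≤ ENNReal.ofReal (3 * d) * r ^ (-(1 / 2) : ℝ) := by
  have key (r : ℝ≥0) (hr : 0 < r) : P {ω | r ≤ hitTime d (sample (B · ω))} ≤
      ENNReal.ofReal (3 * d) * (r : ℝ≥0∞) ^ (-(1 / 2) : ℝ) := by
    rw [coe_rpow_neg_half hr, ← ENNReal.ofReal_mul (by positivity)]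
    have h1 : P {ω | r ≤ hitTime d (sample (B · ω))} ≤
        P {ω | (B · ω) ∈ belowOn r (2 * d)} := by
      refine measure_mono_ae ?_
      filter_upwards [hB.cont] with ω hω h
      exact mem_belowOn_of_le_hitTime hω hr (by linarith) h
    refine h1.trans ?_
    rw [← ofReal_measureReal]
    refine ENNReal.ofReal_le_ofReal ?_
    refine (measureReal_mem_belowOn_le hB r (by positivity : 0 < 2 * d) hd).trans ?_
    -- One extra `d` makes the inequality strict, another is the overshoot margin.
    rw [show 2 * d + d = 3 * d by ring, ← div_eq_mul_inv]
    exact gaussianReal_zero_real_Icc_le hr.ne' (by positivity)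
  obtain rfl | hr0 := eq_or_ne r 0
  · rw [ENNReal.zero_rpow_of_neg (by norm_num), ENNReal.mul_top (by simpa using hd)]
    exact le_top
  obtain rfl | hr := eq_or_ne r ⊤
  -- For `r = ⊤` the bound is the limit of the finite ones.
  · have hlim : Filter.Tendsto (fun n : ℕ ↦ ENNReal.ofReal (3 * d) *
        (((n + 1 : ℕ) : ℝ≥0) : ℝ≥0∞) ^ (-(1 / 2) : ℝ)) Filter.atTop
        (nhds (ENNReal.ofReal (3 * d) * (⊤ : ℝ≥0∞) ^ (-(1 / 2) : ℝ))) := by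
      refine ENNReal.Tendsto.const_mul ?_ (Or.inr ENNReal.ofReal_ne_top)
      refine ((ENNReal.continuous_rpow_const).tendsto _).comp ?_
      exact (ENNReal.tendsto_nat_nhds_top.comp (Filter.tendsto_add_atTop_nat 1))
    refine ge_of_tendsto hlim (Filter.Eventually.of_forall fun n ↦ ?_)
    refine le_trans (measure_mono fun ω hω ↦ ?_) (key ((n + 1 : ℕ) : ℝ≥0) (by positivity))
    exact le_top.trans (show (⊤ : ℝ≥0∞) ≤ _ from hω)
  · lift r to ℝ≥0 using hr
    exact key r (pos_iff_ne_zero.2 (by simpa using hr0))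

/-- The running maximum of a path up to time `t`, in units of `√t`. -/
noncomputable def scaledMax (t : ℝ≥0) (f : ℕ → ℝ) : ℝ≥0∞ := runMax t f / NNReal.sqrt t

lemma measurable_scaledMax (t : ℝ≥0) : Measurable (scaledMax t) :=
  (measurable_runMax t).div_const _

lemma le_of_scaledMax_le {f : ℝ≥0 → ℝ} (hf : Continuous f) {t : ℝ≥0} (ht : 0 < t) {ε : ℝ≥0}
    (h : scaledMax t (sample f) ≤ ε) {s : ℝ≥0} (hs : s ≤ t) : f s ≤ ε * √(t : ℝ) := by
  have hst : 0 < NNReal.sqrt t := NNReal.sqrt_pos.2 ht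
  rw [scaledMax, ENNReal.div_le_iff (by simpa using hst.ne') (by simp), ← ENNReal.coe_mul] at h
  simpa using le_of_runMax_le hf ht h hs

lemma measure_scaledMax_le (hB : IsBrownianReal B P) {t : ℝ≥0} (ht : 0 < t) {ε : ℝ≥0}
    (hε : 0 < ε) : P {ω | scaledMax t (sample (B · ω)) ≤ ε} ≤ 3 * (ε : ℝ≥0∞) ^ (1 : ℝ) := by
  have hst : 0 < √(t : ℝ) := by positivity
  have hε' : (0 : ℝ) < ε := hε
  have h1 : P {ω | scaledMax t (sample (B · ω)) ≤ ε} ≤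
      P {ω | (B · ω) ∈ belowOn t (2 * (ε * √(t : ℝ)))} := by
    refine measure_mono_ae ?_
    filter_upwards [hB.cont] with ω hω h
    exact mem_belowOn_of_le (d := ε * √(t : ℝ)) (by linarith [mul_pos hε' hst])
      fun s hs ↦ le_of_scaledMax_le hω ht h hs
  refine h1.trans ?_
  rw [← ofReal_measureReal, ENNReal.rpow_one, ← ENNReal.ofReal_coe_nnreal,
    ← ENNReal.ofReal_ofNat, ← ENNReal.ofReal_mul (by positivity)]
  refine ENNReal.ofReal_le_ofReal ?_
  refine (measureReal_mem_belowOn_le hB t (by positivity)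
    (by positivity : 0 < ε * √(t : ℝ))).trans ?_
  refine (gaussianReal_zero_real_Icc_le ht.ne' (by positivity)).trans_eq ?_
  field_simp
  ring

/-- Small ball estimate for Brownian motion. -/
lemma measure_max_scaledMax_le (hB : IsBrownianReal B P) {t : ℝ≥0} (ht : 0 < t) {ε : ℝ≥0} :
    P {ω | max (scaledMax t (sample (B · ω))) (scaledMax t (sample (-(B · ω)))) ≤ ε} ≤
      4 * (ε : ℝ≥0∞) ^ (2 : ℝ) := by
  have hst : 0 < √(t : ℝ) := by positivity
  set h : ℝ≥0 := t / 2 with hh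
  have hh0 : h ≠ 0 := by positivity
  have hht : (2 : ℕ) * h = t := by rw [hh]; push_cast; field_simp
  set e : ℝ := ε * √(t : ℝ) with he
  -- Only the times `t / 2` and `t` are used: `B (t / 2)` lies in `[-e, e]` and the next increment
  -- in `[-2e, 2e]`. These are independent events, each of probability `O(ε)`.
  have h1 : P {ω | max (scaledMax t (sample (B · ω))) (scaledMax t (sample (-(B · ω)))) ≤ ε} ≤
      P ((B ((2 : ℕ) * h) - B ((1 : ℕ) * h)) ⁻¹' Icc (-(2 * e)) (2 * e) ∩
        (fun ω (j : Iic (1 : ℕ)) ↦ B (j * h) ω) ⁻¹'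
        (fun f : Iic (1 : ℕ) → ℝ ↦ f ⟨1, by simp⟩) ⁻¹' Icc (-e) e) := by
    refine measure_mono_ae ?_
    filter_upwards [hB.cont] with ω hω hmax
    have h' := max_le_iff.1 (show max _ _ ≤ (ε : ℝ≥0∞) from hmax)
    have hle (s : ℝ≥0) (hs : s ≤ t) : B s ω ∈ Icc (-e) e :=
      ⟨neg_le.1 (le_of_scaledMax_le (f := -(B · ω)) hω.neg ht h'.2 hs),
        le_of_scaledMax_le hω ht h'.1 hs⟩
    have ha := hle _ hht.le
    have hb := hle ((1 : ℕ) * h) (by simp [hh])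
    refine ⟨?_, hb⟩
    simp only [mem_preimage, Pi.sub_apply, mem_Icc] at ha hb ⊢
    constructor <;> linarith
  refine h1.trans ?_
  rw [(IsPreBrownianReal.indepFun_walk hB.toIsPreBrownianReal h one_le_two).measure_inter_preimage_eq_mul
    _ _ measurableSet_Icc (measurableSet_Icc.preimage (measurable_pi_apply _))]
  have h2 : P.real ((B ((2 : ℕ) * h) - B ((1 : ℕ) * h)) ⁻¹' Icc (-(2 * e)) (2 * e)) ≤
      2 * e / √(h : ℝ) := by
    rw [IsPreBrownianReal.measureReal_sub_preimage hB.toIsPreBrownianReal _ _ measurableSet_Icc]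
    have : nndist ((2 : ℕ) * h).1 ((1 : ℕ) * h).1 = h := by
      rw [← NNReal.coe_inj, coe_nndist, Real.dist_eq]
      simp only [NNReal.val_eq_coe]
      push_cast
      rw [show (2 : ℝ) * h - 1 * h = h by ring, abs_of_nonneg (by positivity)]
    rw [this]
    exact gaussianReal_zero_real_Icc_le hh0 (by positivity)
  have h3 : P.real ((fun ω (j : Iic (1 : ℕ)) ↦ B (j * h) ω) ⁻¹'
        (fun f : Iic (1 : ℕ) → ℝ ↦ f ⟨1, by simp⟩) ⁻¹' Icc (-e) e) ≤
      e / √(h : ℝ) := by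
    refine le_trans (le_of_eq ?_) (gaussianReal_zero_real_Icc_le hh0 (by positivity))
    rw [← IsPreBrownianReal.measureReal_preimage hB.toIsPreBrownianReal h measurableSet_Icc]
    congr 1
    ext ω
    simp
  rw [← ofReal_measureReal, ← ofReal_measureReal, ← ENNReal.ofReal_mul measureReal_nonneg]
  have h4 : (4 : ℝ≥0∞) * (ε : ℝ≥0∞) ^ (2 : ℝ) = ENNReal.ofReal (4 * ε ^ 2) := by
    rw [ENNReal.ofReal_mul (by norm_num), ENNReal.ofReal_pow (by positivity),
      ENNReal.ofReal_coe_nnreal, ENNReal.ofReal_ofNat, ENNReal.rpow_ofNat]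
  rw [h4]
  refine ENNReal.ofReal_le_ofReal ?_
  calc _ ≤ 2 * e / √(h : ℝ) * (e / √(h : ℝ)) := by gcongr
    _ = 2 * e ^ 2 / (√(h : ℝ)) ^ 2 := by ring
    _ = 4 * ε ^ 2 := by
      have ht' : (0 : ℝ) < t := ht
      rw [he, mul_pow, Real.sq_sqrt (by positivity), Real.sq_sqrt (by positivity), hh]
      push_cast
      field_simp
      ring

/-- A bound for the mixed moment of order `-1/2` of the scaled maximum and minimum. -/
noncomputable def extremaMomentBound : ℝ≥0∞ :=
  negMomentBound 3 1 (3 / 4) + negMomentBound 3 1 (3 / 4) + negMomentBound 4 2 (3 / 2)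

lemma extremaMomentBound_ne_top : extremaMomentBound ≠ ⊤ := by
  have h1 := negMomentBound_ne_top (C := 3) (by simp) (p := 1) (q := 3 / 4) (by norm_num)
  have h2 := negMomentBound_ne_top (C := 4) (by simp) (p := 2) (q := 3 / 2) (by norm_num)
  simp [extremaMomentBound, h1, h2]

lemma lintegral_scaledMax_rpow_mul_le (hB : IsBrownianReal B P) {t : ℝ≥0} (ht : 0 < t) :
    ∫⁻ ω, scaledMax t (sample (B · ω)) ^ (-(1 / 2) : ℝ) *
      scaledMax t (sample (-(B · ω))) ^ (-(1 / 2) : ℝ) ∂P ≤ extremaMomentBound := by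
  have hm1 : AEMeasurable (fun ω ↦ scaledMax t (sample (B · ω))) P :=
    (measurable_scaledMax t).comp_aemeasurable (aemeasurable_sample hB.aemeasurable)
  have hm2 : AEMeasurable (fun ω ↦ scaledMax t (sample (-(B · ω)))) P :=
    (measurable_scaledMax t).comp_aemeasurable (aemeasurable_sample hB.neg.aemeasurable)
  refine (lintegral_mono fun ω ↦ rpow_neg_half_mul_le _ _).trans ?_
  have hm1' := hm1.pow_const (-(3 / 4) : ℝ)
  have hm2' := hm2.pow_const (-(3 / 4) : ℝ)
  rw [lintegral_add_left' (by fun_prop), lintegral_add_left' hm1']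
  refine add_le_add (add_le_add ?_ ?_) ?_
  · exact lintegral_rpow_neg_le hm1 (by norm_num) fun ε hε ↦ measure_scaledMax_le hB ht hε
  · exact lintegral_rpow_neg_le hm2 (by norm_num) fun ε hε ↦ measure_scaledMax_le hB.neg ht hε
  · exact lintegral_rpow_neg_le (hm1.max hm2) (by norm_num)
      fun ε hε ↦ measure_max_scaledMax_le hB ht

end BrownianEstimates

/-! ### Conditioning on the extrema -/

section Independence

open scoped ENNReal

variable {Ω : Type*} {mΩ : MeasurableSpace Ω} {P : Measure Ω} [IsProbabilityMeasure P]

/-- Conditioning on `(M₁, M₂)`, which is independent of the independent pair `(σ₁, σ₂)`. -/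
lemma measure_le_and_le_le_lintegral {σ₁ σ₂ M₁ M₂ : Ω → ℝ≥0∞} (hσ₁ : AEMeasurable σ₁ P)
    (hσ₂ : AEMeasurable σ₂ P) (hM₁ : AEMeasurable M₁ P) (hM₂ : AEMeasurable M₂ P)
    (hσ : IndepFun σ₁ σ₂ P)
    (hM : IndepFun (fun ω ↦ (M₁ ω, M₂ ω)) (fun ω ↦ (σ₁ ω, σ₂ ω)) P) {G : ℝ≥0∞ → ℝ≥0∞}
    (hG : Measurable G) (h₁ : ∀ r, P {ω | r ≤ σ₁ ω} ≤ G r) (h₂ : ∀ r, P {ω | r ≤ σ₂ ω} ≤ G r) :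
    P {ω | M₁ ω ≤ σ₁ ω ∧ M₂ ω ≤ σ₂ ω} ≤ ∫⁻ ω, G (M₁ ω) * G (M₂ ω) ∂P := by
  have hA : MeasurableSet {z : (ℝ≥0∞ × ℝ≥0∞) × (ℝ≥0∞ × ℝ≥0∞) |
      z.1.1 ≤ z.2.1 ∧ z.1.2 ≤ z.2.2} := by
    rw [ofPred_and]
    exact (measurableSet_le (by fun_prop) (by fun_prop)).inter
      (measurableSet_le (by fun_prop) (by fun_prop))
  have hMm := hM₁.prodMk hM₂
  have hσm := hσ₁.prodMk hσ₂
  have h := Measure.map_apply_of_aemeasurable (hMm.prodMk hσm) hA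
  rw [(indepFun_iff_map_prod_eq_prod_map_map hMm hσm).1 hM, Measure.prod_apply hA] at h
  refine (h.symm.trans_le (lintegral_mono (g := fun v ↦ G v.1 * G v.2) fun v ↦ ?_)).trans_eq
    (lintegral_map' (by fun_prop) hMm)
  rw [Measure.map_apply_of_aemeasurable hσm (measurable_prodMk_left hA)]
  refine le_trans (le_of_eq ?_) (mul_le_mul' (h₁ v.1) (h₂ v.2))
  exact hσ.measure_inter_preimage_eq_mul _ _ (measurableSet_Ici (a := v.1))
    (measurableSet_Ici (a := v.2))

end Independence

/-! ### The two bounds for iterated Brownian motion -/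

section IteratedBrownianMotion

open scoped ENNReal

variable {Ω : Type*}

lemma mem_of_lt_lifetime {Z : ℝ≥0 → Ω → ℝ} {D : Set ℝ} {ω : Ω} {t : ℝ≥0}
    (h : (t : WithTop ℝ≥0) < lifetime Z D ω) {s : ℝ≥0} (hs : s ≤ t) : Z s ω ∈ D := by
  have := notMem_of_lt_hittingAfter (lt_of_le_of_lt (WithTop.coe_le_coe.2 hs) h) zero_le
  simpa using this

/-- The margin `t < T` replaces path continuity: without it, exit times could accumulate at `t` from
the right. -/
lemma lt_lifetime {Z : ℝ≥0 → Ω → ℝ} {D : Set ℝ} {ω : Ω} {t T : ℝ≥0} (htT : t < T)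
    (h : ∀ s ≤ T, Z s ω ∈ D) : (t : WithTop ℝ≥0) < lifetime Z D ω := by
  rw [lifetime, hittingAfter]
  split_ifs with hex
  · refine WithTop.coe_lt_coe.2 (htT.trans_le (le_csInf hex fun s hs ↦ ?_))
    by_contra! H
    exact hs.2 (h s H.le)
  · exact WithTop.coe_lt_top t

lemma lifetime_neg (Z : ℝ≥0 → Ω → ℝ) (b : ℝ) : lifetime (-Z) (Iio (-b)) = lifetime Z (Ioi b) := by
  ext ω
  have hmem (j : ℝ≥0) : (-Z) j ω ∈ (Iio (-b))ᶜ ↔ Z j ω ∈ (Ioi b)ᶜ := by simp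
  simp only [lifetime, hittingAfter, hmem]
  congr 1
  simp only [hmem]

variable [MeasurableSpace Ω] {P : Measure Ω}

/-- The upper bound: condition on `Y`, and use that the two sides of `X` stay below the level on the
range of `Y` independently of each other. -/
lemma measure_lt_lifetime_Iio_le [IsProbabilityMeasure P] {x a : ℝ} (hxa : x < a)
    {Z : ℝ≥0 → Ω → ℝ} (hZ : IsIteratedBrownianMotion P x Z) {t : ℝ≥0} (ht : 0 < t) :
    P {ω | (t : WithTop ℝ≥0) < lifetime Z (Iio a) ω} ≤
      ENNReal.ofReal (3 * (a - x)) ^ 2 * extremaMomentBound * (t : ℝ≥0∞) ^ (-(1 / 2) : ℝ) := by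
  obtain ⟨Xp, Xm, Y, hXp, hXm, hY, hind, rfl⟩ := hZ
  set d := a - x with hd
  have hd0 : 0 < d := sub_pos.2 hxa
  let φ : (ℝ≥0 → ℝ) → ℝ≥0∞ × ℝ≥0∞ × ℝ≥0∞ := fun f ↦
    (hitTime d (sample f), runMax t (sample f), runMax t (sample (-f)))
  have hψ : Measurable fun f : ℝ≥0 → ℝ ↦ runMax t (sample (-f)) :=
    (measurable_runMax t).comp (measurable_sample.comp measurable_neg)
  have hφ : Measurable φ := ((measurable_hitTime d).comp measurable_sample).prodMk
    (((measurable_runMax t).comp measurable_sample).prodMk hψ)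
  have haem (B : ℝ≥0 → Ω → ℝ) (hB : IsBrownianReal B P) :
      AEMeasurable (fun ω ↦ φ (B · ω)) P :=
    ((measurable_hitTime d).comp_aemeasurable (aemeasurable_sample hB.aemeasurable)).prodMk
      (((measurable_runMax t).comp_aemeasurable (aemeasurable_sample hB.aemeasurable)).prodMk
        ((measurable_runMax t).comp_aemeasurable (aemeasurable_sample hB.neg.aemeasurable)))
  have hφind := hind.comp (fun _ ↦ φ) (fun _ ↦ hφ)
  have haem' (i : Fin 3) : AEMeasurable
      (φ ∘ fun ω (t : ℝ≥0) ↦ (![Xp, Xm, Y] i) t ω) P := by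
    fin_cases i
    · exact haem _ hXp
    · exact haem _ hXm
    · exact haem _ hY
  have hσ : IndepFun (fun ω ↦ hitTime d (sample (Xp · ω))) (fun ω ↦ hitTime d (sample (Xm · ω))) P :=
    (hφind.indepFun (show (0 : Fin 3) ≠ 1 by decide)).comp measurable_fst measurable_fst
  have hM : IndepFun
      (fun ω ↦ (runMax t (sample (Y · ω)), runMax t (sample (-(Y · ω)))))
      (fun ω ↦ (hitTime d (sample (Xp · ω)), hitTime d (sample (Xm · ω)))) P :=
    ((hφind.indepFun_prodMk₀ haem' 0 1 2 (by decide) (by decide)).comp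
      (φ := fun z ↦ (z.1.1, z.2.1)) (ψ := fun z ↦ z.2) (by fun_prop) (by fun_prop)).symm
  have hG : Measurable fun r : ℝ≥0∞ ↦ ENNReal.ofReal (3 * d) * r ^ (-(1 / 2) : ℝ) := by fun_prop
  have hle := measure_le_and_le_le_lintegral (haem _ hXp).fst (haem _ hXm).fst
    (haem _ hY).snd.fst (haem _ hY).snd.snd hσ hM hG (measure_le_hitTime_le hXp hd0)
    (measure_le_hitTime_le hXm hd0)
  calc P {ω | (t : WithTop ℝ≥0) < lifetime (iteratedProcess Xp Xm Y x) (Iio a) ω}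
      ≤ P {ω | runMax t (sample (Y · ω)) ≤ hitTime d (sample (Xp · ω)) ∧
          runMax t (sample (-(Y · ω))) ≤ hitTime d (sample (Xm · ω))} := by
        refine measure_mono_ae ?_
        filter_upwards [hY.cont, hY.eval_zero_ae_eq_zero, hXm.eval_zero_ae_eq_zero]
          with ω hc h0 hm0 hω
        have hlt (s : ℝ≥0) (hs : s ≤ t) : twoSided Xp Xm (Y s ω) ω < d := by
          have : iteratedProcess Xp Xm Y x s ω < a := mem_of_lt_lifetime hω hs
          rw [iteratedProcess] at this
          linarith
        refine ⟨runMax_le_hitTime hc h0 fun s hs r hr ↦ ?_,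
          runMax_le_hitTime hc.neg (by simpa using h0) fun s hs r hr ↦ ?_⟩
        · have := hlt s hs
          rw [hr] at this
          simpa [twoSided] using this
        · have := hlt s hs
          -- At `0` the two-sided path reads `Xp`, so the bound on `Xm 0` comes from `Xm 0 = 0 < d`.
          obtain rfl | hr0 := eq_or_ne r 0
          · rwa [hm0]
          have hYs : Y s ω = -r := by rw [← hr]; simp
          have hr0' : ¬ (0 : ℝ) ≤ -r := by
            have : (0 : ℝ) < r := by positivity
            linarith
          rw [twoSided, hYs, if_neg hr0'] at this
          simpa using this
    _ ≤ _ := hle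
    _ = ENNReal.ofReal (3 * d) ^ 2 * (t : ℝ≥0∞) ^ (-(1 / 2) : ℝ) *
        ∫⁻ ω, scaledMax t (sample (Y · ω)) ^ (-(1 / 2) : ℝ) *
          scaledMax t (sample (-(Y · ω))) ^ (-(1 / 2) : ℝ) ∂P := by
        have hs : (NNReal.sqrt t : ℝ≥0∞) ≠ 0 := by simpa using ht.ne'
        -- Each extremum releases a factor `(√t)^(-1/2) = t^(-1/4)`.
        have hscale (f : ℕ → ℝ) : runMax t f ^ (-(1 / 2) : ℝ) =
            (NNReal.sqrt t : ℝ≥0∞) ^ (-(1 / 2) : ℝ) * scaledMax t f ^ (-(1 / 2) : ℝ) := by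
          have hs' : (NNReal.sqrt t : ℝ≥0∞) ^ (1 / 2 : ℝ) ≠ 0 := by
            simp [ENNReal.rpow_eq_zero_iff, ht.ne']
          have hs'' : (NNReal.sqrt t : ℝ≥0∞) ^ (1 / 2 : ℝ) ≠ ⊤ := by
            simp [ENNReal.rpow_eq_top_iff]
          rw [ENNReal.rpow_neg, ENNReal.rpow_neg, ENNReal.rpow_neg,
            ← ENNReal.mul_inv (Or.inl hs') (Or.inl hs''),
            ← ENNReal.mul_rpow_of_nonneg _ _ (by norm_num), scaledMax,
            ENNReal.mul_div_cancel hs ENNReal.coe_ne_top]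
        have hsq : (NNReal.sqrt t : ℝ≥0∞) ^ (-(1 / 2) : ℝ) * (NNReal.sqrt t : ℝ≥0∞) ^ (-(1 / 2) : ℝ)
            = (t : ℝ≥0∞) ^ (-(1 / 2) : ℝ) := by
          rw [← ENNReal.mul_rpow_of_ne_zero hs hs, ← ENNReal.coe_mul, NNReal.mul_self_sqrt]
        rw [← lintegral_const_mul'' _ (by
          have h1 := (haem _ hY).snd.fst.div_const (NNReal.sqrt t : ℝ≥0∞)
          have h2 := (haem _ hY).snd.snd.div_const (NNReal.sqrt t : ℝ≥0∞)
          exact (h1.pow_const _).mul (h2.pow_const _))]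
        refine lintegral_congr fun ω ↦ ?_
        rw [hscale, hscale, ← hsq]
        ring
    _ ≤ ENNReal.ofReal (3 * d) ^ 2 * (t : ℝ≥0∞) ^ (-(1 / 2) : ℝ) * extremaMomentBound := by
        gcongr
        exact lintegral_scaledMax_rpow_mul_le hY ht
    _ = _ := by ring

/-- The lower bound: `Y` stays in an interval of length of order `√t` with probability at least
`1 / 2`, and `X` stays below the level on that interval with probability of order `t ^ (-1/2)`. -/
lemma le_measureReal_lt_lifetime_Iio [IsProbabilityMeasure P] {x a : ℝ} (hxa : x < a)
    {Z : ℝ≥0 → Ω → ℝ} (hZ : IsIteratedBrownianMotion P x Z) {t : ℝ≥0} (ht : 1 ≤ t)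
    (hta : (a - x) ^ 2 ≤ √(t : ℝ)) :
    (a - x) ^ 2 / 432 / √(t : ℝ) ≤ P.real {ω | (t : WithTop ℝ≥0) < lifetime Z (Iio a) ω} := by
  obtain ⟨Xp, Xm, Y, hXp, hXm, hY, hind, rfl⟩ := hZ
  set d := a - x with hd
  have hd0 : 0 < d := sub_pos.2 hxa
  set T : ℝ≥0 := t + 1 with hT
  have ht0 : (1 : ℝ) ≤ t := by exact_mod_cast ht
  -- By Lévy and Chebyshev each of `Y`, `-Y` exceeds `L` with probability at most `2 T / L² = 2/9`,
  -- and `4/9 < 1/2`.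
  set L : ℝ≥0 := 3 * NNReal.sqrt T with hL
  have hLr : (L : ℝ) = 3 * √(T : ℝ) := by simp [hL]
  have hTs : √(T : ℝ) ≤ 2 * √(t : ℝ) := by
    rw [Real.sqrt_le_left (by positivity), mul_pow, Real.sq_sqrt (by positivity), hT]
    push_cast
    linarith
  have hsT : √(t : ℝ) ≤ √(T : ℝ) := Real.sqrt_le_sqrt (by rw [hT]; push_cast; linarith)
  have hL0 : 0 < L := by rw [← NNReal.coe_pos, hLr]; positivity
  have hLpos : (0 : ℝ) < L := hL0
  -- The level `d / 2` leaves room for a strict inequality at `d`.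
  have hX (X : ℝ≥0 → Ω → ℝ) (h : IsBrownianReal X P) :
      d / 2 / (3 * √(L : ℝ)) ≤ P.real {ω | (X · ω) ∈ belowOn L (d / 2)} := by
    refine le_trans ?_ (le_measureReal_mem_belowOn h.toIsPreBrownianReal L (d / 2))
    refine le_trans ?_ (gaussianReal_zero_real_Ioo_le L (by positivity))
    refine le_gaussianReal_zero_real_Ioo hL0.ne' (by positivity) ?_
    refine Real.le_sqrt_of_sq_le ?_
    rw [hLr]
    nlinarith [Real.sqrt_nonneg (T : ℝ)]
  have hYb (B : ℝ≥0 → Ω → ℝ) (h : IsBrownianReal B P) :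
      P.real {ω | (B · ω) ∉ belowOn T L} ≤ 2 / 9 := by
    refine (measureReal_notMem_belowOn_le h.toIsPreBrownianReal T L).trans ?_
    have := gaussianReal_zero_real_Ici_le (v := T) hLpos
    have hT0 : (0 : ℝ) < T := by positivity
    rw [hLr, mul_pow, Real.sq_sqrt (by positivity)] at this
    have h9 : (T : ℝ) / (3 ^ 2 * T) = 1 / 9 := by field_simp; norm_num
    rw [h9, ← hLr] at this
    linarith
  let A : Set (ℝ≥0 → ℝ) := belowOn T L ∩ {f | -f ∈ belowOn T L}
  have hA : MeasurableSet A :=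
    (measurableSet_belowOn _ _).inter ((measurableSet_belowOn _ _).preimage measurable_neg)
  have hYA : 1 / 2 ≤ P.real {ω | (Y · ω) ∈ A} := by
    have h1 := measureReal_union_le (μ := P) ({ω | (Y · ω) ∉ belowOn T L} ∪
      {ω | (fun t ↦ (-Y) t ω) ∉ belowOn T L}) {ω | (Y · ω) ∈ A}
    have h2 := measureReal_union_le (μ := P) {ω | (Y · ω) ∉ belowOn T L}
      {ω | (fun t ↦ (-Y) t ω) ∉ belowOn T L}
    have h3 : ({ω | (Y · ω) ∉ belowOn T L} ∪ {ω | (fun t ↦ (-Y) t ω) ∉ belowOn T L}) ∪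
        {ω | (Y · ω) ∈ A} = univ := by
      refine eq_univ_of_forall fun ω ↦ ?_
      by_cases h4 : (Y · ω) ∈ belowOn T L
      · by_cases h5 : (fun t ↦ (-Y) t ω) ∈ belowOn T L
        · exact Or.inr ⟨h4, h5⟩
        · exact Or.inl (Or.inr h5)
      · exact Or.inl (Or.inl h4)
    rw [h3, probReal_univ] at h1
    linarith [hYb Y hY, hYb (-Y) hY.neg]
  have hprod : P.real ({ω | (Xp · ω) ∈ belowOn L (d / 2)} ∩ {ω | (Xm · ω) ∈ belowOn L (d / 2)} ∩
      {ω | (Y · ω) ∈ A}) = P.real {ω | (Xp · ω) ∈ belowOn L (d / 2)} *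
        P.real {ω | (Xm · ω) ∈ belowOn L (d / 2)} * P.real {ω | (Y · ω) ∈ A} := by
    have := hind.measure_inter_preimage_eq_mul Finset.univ
      (sets := ![belowOn L (d / 2), belowOn L (d / 2), A]) (fun i _ ↦ by
        fin_cases i
        · exact measurableSet_belowOn _ _
        · exact measurableSet_belowOn _ _
        · exact hA)
    rw [Fin.prod_univ_three] at this
    simp only [measureReal_def, ← ENNReal.toReal_mul]
    congr 1
    refine Eq.trans (congrArg P ?_) this
    ext ω
    simp [Fin.forall_fin_succ, and_assoc]
  -- Since `L = 3 √T ≤ 6 √t`, the denominator `72 L` is at most `432 √t`.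
  calc d ^ 2 / 432 / √(t : ℝ) ≤ d / 2 / (3 * √(L : ℝ)) * (d / 2 / (3 * √(L : ℝ))) * (1 / 2) := by
        have : d / 2 / (3 * √(L : ℝ)) * (d / 2 / (3 * √(L : ℝ))) * (1 / 2) =
            d ^ 2 / (72 * (√(L : ℝ)) ^ 2) := by field_simp; norm_num
        rw [this, Real.sq_sqrt (by positivity), hLr, div_div]
        exact div_le_div_of_nonneg_left (by positivity) (by positivity) (by linarith)
    _ ≤ P.real {ω | (Xp · ω) ∈ belowOn L (d / 2)} *
        P.real {ω | (Xm · ω) ∈ belowOn L (d / 2)} * P.real {ω | (Y · ω) ∈ A} := by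
        gcongr
        · exact hX Xp hXp
        · exact hX Xm hXm
    _ ≤ _ := by
        rw [← hprod]
        refine ENNReal.toReal_mono (measure_ne_top _ _) (measure_mono_ae ?_)
        filter_upwards [hXp.cont, hXm.cont, hY.cont] with ω hcp hcm hcY hω
        obtain ⟨⟨hp, hm⟩, hy1, hy2⟩ := hω
        refine lt_lifetime (T := T) (by simp [hT]) fun s hs ↦ ?_
        have h1 := le_of_mem_belowOn hcY hy1 hs
        have h2 := le_of_mem_belowOn (f := -(Y · ω)) hcY.neg hy2 hs
        simp only [Pi.neg_apply] at h2
        have h3 : twoSided Xp Xm (Y s ω) ω ≤ d / 2 := by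
          rw [twoSided]
          split_ifs with h
          · exact le_of_mem_belowOn hcp hp (Real.toNNReal_le_iff_le_coe.2 h1)
          · exact le_of_mem_belowOn hcm hm (Real.toNNReal_le_iff_le_coe.2 h2)
        simp only [mem_Iio, iteratedProcess]
        linarith

/-- Negating `X⁺` and `X⁻` but not `Y` negates `Z - x`. This reduces `(b, ∞)` to `(-∞, -b)`. -/
lemma IsIteratedBrownianMotion.neg {x : ℝ} {Z : ℝ≥0 → Ω → ℝ}
    (hZ : IsIteratedBrownianMotion P x Z) : IsIteratedBrownianMotion P (-x) (-Z) := by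
  obtain ⟨Xp, Xm, Y, hXp, hXm, hY, hind, rfl⟩ := hZ
  refine ⟨-Xp, -Xm, Y, hXp.neg, hXm.neg, hY, ?_, ?_⟩
  · have := hind.comp (![fun f ↦ -f, fun f ↦ -f, id]) (fun i ↦ by
      fin_cases i
      · exact measurable_neg
      · exact measurable_neg
      · exact measurable_id)
    convert this using 1
    ext i ω t
    fin_cases i <;> rfl
  · ext t ω
    simp only [Pi.neg_apply, iteratedProcess, twoSided]
    split_ifs <;> ring

end IteratedBrownianMotion

theorem corollary1p4 (D : Set ℝ) (hD : (∃ a : ℝ, D = Iio a) ∨ (∃ b : ℝ, D = Ioi b))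
    (x : ℝ) (hx : x ∈ D) :
    ∃ C₁ C₂ : ℝ, ∃ T : ℝ≥0, 0 < C₁ ∧ 0 < C₂ ∧ 0 < T ∧
      ∀ (Ω : Type*) [MeasurableSpace Ω] (P : Measure Ω) [IsProbabilityMeasure P]
        (Z : ℝ≥0 → Ω → ℝ), IsIteratedBrownianMotion P x Z →
        ∀ t : ℝ≥0, T ≤ t →
          C₁ ≤ P.real {ω | (t : WithTop ℝ≥0) < lifetime Z D ω} / (t : ℝ) ^ (-(1 / 2) : ℝ) ∧
          P.real {ω | (t : WithTop ℝ≥0) < lifetime Z D ω} / (t : ℝ) ^ (-(1 / 2) : ℝ) ≤ C₂ := by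
  wlog hD' : ∃ a : ℝ, D = Iio a generalizing D x
  · obtain ⟨b, rfl⟩ := hD.resolve_left hD'
    obtain ⟨C₁, C₂, T, h1, h2, h3, h⟩ := this (Iio (-b)) (Or.inl ⟨_, rfl⟩) (-x)
      (by simpa using hx) ⟨_, rfl⟩
    refine ⟨C₁, C₂, T, h1, h2, h3, fun Ω _ P _ Z hZ t ht ↦ ?_⟩
    have := h Ω P (-Z) hZ.neg t ht
    rwa [lifetime_neg] at this
  obtain ⟨a, rfl⟩ := hD'
  have hxa : x < a := hx
  have hd : 0 < a - x := sub_pos.2 hxa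
  set C : ENNReal := ENNReal.ofReal (3 * (a - x)) ^ 2 * extremaMomentBound with hC
  have hCtop : C ≠ ⊤ := ENNReal.mul_ne_top (ENNReal.pow_ne_top ENNReal.ofReal_ne_top)
    extremaMomentBound_ne_top
  -- The threshold ensures `1 ≤ t` and `(a - x) ^ 2 ≤ √t`; the `+ 1` in the upper constant makes its
  -- positivity immediate.
  refine ⟨(a - x) ^ 2 / 432, C.toReal + 1, 1 + ((a - x) ^ 2).toNNReal ^ 2, by positivity,
    by positivity, by positivity, fun Ω _ P _ Z hZ t ht ↦ ?_⟩
  have ht1 : 1 ≤ t := le_self_add.trans ht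
  have ht0 : 0 < t := zero_lt_one.trans_le ht1
  have hrpow : (t : ℝ) ^ (-(1 / 2) : ℝ) = (√(t : ℝ))⁻¹ := by
    rw [Real.rpow_neg (by positivity), Real.sqrt_eq_rpow]
  rw [hrpow, div_inv_eq_mul]
  have hst : 0 < √(t : ℝ) := by positivity
  constructor
  · rw [← div_le_iff₀ hst]
    refine le_measureReal_lt_lifetime_Iio hxa hZ ht1 (Real.le_sqrt_of_sq_le ?_)
    have h : ((a - x) ^ 2).toNNReal ^ 2 ≤ t := le_add_self.trans ht
    have h' := NNReal.coe_le_coe.2 h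
    rwa [NNReal.coe_pow, Real.coe_toNNReal _ (by positivity)] at h'
  · have h := measure_lt_lifetime_Iio_le hxa hZ ht0
    rw [← hC, coe_rpow_neg_half ht0] at h
    have h' := ENNReal.toReal_mono (ENNReal.mul_ne_top hCtop ENNReal.ofReal_ne_top) h
    rw [ENNReal.toReal_mul, ENNReal.toReal_ofReal (by positivity), ← div_eq_mul_inv,
      le_div_iff₀ hst] at h'
    exact h'.trans (by linarith)
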